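/- Let $S$ be a countable (finite or infinite) set and let $(X_n)_{n\ge 0}$ be a time-homogeneous discrete-time Markov chain with state space $S$, transition matrix $(p_{ij})_{i,j\in S}$ and arbitrary initial distribution, defined on a probability space $(\Omega,\mathcal F,\mathbb P)$. The chain is not assumed to be irreducible. For $j\in S$ let $P_j$ denote the law of the chain with transition matrix $(p_{ij})$ started at $j$, let $\tau_j=\inf\{n\ge 1: x_n=j\}\in\{1,2,\dots\}\cup\{\infty\}$ be the first return time of a path $(x_n)_{n\ge 0}$ to $j$, and let $m_j=\mathbb E_{P_j}[\tau_j]\in[1,\infty]$ be the mean recurrence time of $j$. The state $j$ is positive recurrent if $P_j(\tau_j<\infty)=1$ and $m_j<\infty$; let $C\subseteq S$ be the set of positive recurrent states. Let $A^j=\{\omega\in\Omega:\exists\, l\in\mathbb N,\ X_l(\omega)=j\}$, where $\mathbb N=\{0,1,2,\dots\}$, be the event that the chain ever visits $j$. If $g:S\to\mathbb R$ satisfies $\sum_{i\in S}|g(i)|<\infty$, then, almost surely, the series on the right-hand side below converges absolutely and $$\lim_{n\to\infty}\frac1n\sum_{k=1}^n g(X_k)=\sum_{j\in C}\frac{g(j)}{m_j}\,\mathbf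 1_{A^j}.$$ -/

import Mathlib

open MeasureTheory ProbabilityTheory Filter Topology
open scoped ENNReal

namespace DiscreteMarkov

variable {S : Type*} [MeasurableSpace S]

/-- `X 0, X 1, X 2, …` is a (time-homogeneous, discrete-time) Markov chain on the probability
space `(Ω, μ)` with transition probabilities `p_{ij} = P i {j}`. The initial distribution
`i ↦ μ (X 0 = i)` is arbitrary. -/
structure IsMarkovChain {Ω : Type*} [MeasurableSpace Ω] (μ : Measure Ω) (P : Kernel S S)
    (X : ℕ → Ω → S) : Prop where
  measurable : ∀ n, Measurable (X n)
  /-- `P(X_{n+1} = j | X_0 = x_0, …, X_n = x_n) = p_{x_n j}` whenever the conditioning event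
  has positive probability. -/
  markov : ∀ (n : ℕ) (x : ℕ → S) (j : S),
    μ {ω | ∀ k ≤ n, X k ω = x k} ≠ 0 →
      μ[{ω | X (n + 1) ω = j} | {ω | ∀ k ≤ n, X k ω = x k}] = P (x n) {j}

/-- The one-step kernel seen from a history `(x_0, …, x_n)`: it only looks at `x_n`. -/
noncomputable def stepKernel (P : Kernel S S) (n : ℕ) :
    Kernel ((i : Finset.Iic n) → (fun _ : ℕ => S) i) ((fun _ : ℕ => S) (n + 1)) :=
  P.comap (fun x => x ⟨n, Finset.mem_Iic.2 le_rfl⟩) (measurable_pi_apply _)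

instance (P : Kernel S S) [IsMarkovKernel P] (n : ℕ) : IsMarkovKernel (stepKernel P n) := by
  unfold stepKernel; infer_instance

/-- The law `P_i` on the path space `ℕ → S` of the chain with transition kernel `P` started at
`i` (Ionescu-Tulcea). -/
noncomputable def pathLaw (P : Kernel S S) [IsMarkovKernel P] (i : S) : Measure (ℕ → S) :=
  Kernel.traj (X := fun _ : ℕ => S) (stepKernel P) 0 (fun _ => i)

/-- The first time `n ≥ 1` at which the path is at `j`; it is `∞` if there is none. -/
noncomputable def returnTime (j : S) (x : ℕ → S) : ℝ≥0∞ :=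
  ⨅ (n : ℕ) (_ : 1 ≤ n ∧ x n = j), (n : ℝ≥0∞)

/-- The mean recurrence time `m_j`, the expected return time to `j` of the chain started
at `j`. -/
noncomputable def meanRecurrenceTime (P : Kernel S S) [IsMarkovKernel P] (j : S) : ℝ≥0∞ :=
  ∫⁻ x, returnTime j x ∂(pathLaw P j)

/-- `j` is recurrent: started at `j`, the chain almost surely returns to `j`. -/
def IsRecurrent (P : Kernel S S) [IsMarkovKernel P] (j : S) : Prop :=
  ∀ᵐ x ∂(pathLaw P j), ∃ n : ℕ, 1 ≤ n ∧ x n = j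

/-- `j` is positive recurrent: recurrent with finite mean recurrence time. -/
def IsPositiveRecurrent (P : Kernel S S) [IsMarkovKernel P] (j : S) : Prop :=
  IsRecurrent P j ∧ meanRecurrenceTime P j < ∞

/-- The event `A^j` that the chain ever visits `j`. -/
def visitEvent {Ω : Type*} (X : ℕ → Ω → S) (j : S) : Set Ω :=
  {ω | ∃ l : ℕ, X l ω = j}

end DiscreteMarkov

namespace DiscreteMarkov

/-! The time average of `g` is the sum over `j` of `g j` times the frequency of visits to `j`.
Frequencies are at most 1 and `g` is summable, so dominated convergence for series
(`tendsto_average_of_tendsto_count`) reduces the theorem to the frequency of a single state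
(`IsMarkovChain.ae_tendsto_count_div`).

Fix `j`. Given the past up to a visit to `j`, the wait for the next visit has law `hitProb P j · j`,
of total mass F, the return probability. If F < 1, at least k + 1 visits occur with probability at
most F ^ k, so almost surely there are finitely many and the frequency tends to 0. If F = 1, then
conditionally on `visitEvent X j` there are almost surely infinitely many visits, and the gaps
between them are pairwise independent and identically distributed with mean m_j; the strong law
applied to the visit times gives the frequency 1 / m_j, which is 0 when m_j = ∞. Hence only positive
recurrent states contribute.

The strong Markov property is obtained by summing over the deterministic time of the visit
(`IsMarkovChain.measure_inter_gapEvent`). The mean gap is identified with m_j because the path law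
is itself a Markov chain, so both are computed from `hitProb`. -/

instance {S : Type*} [MeasurableSpace S] (P : Kernel S S) [IsMarkovKernel P] (i : S) :
    IsProbabilityMeasure (pathLaw P i) := by
  unfold pathLaw; infer_instance

theorem pathLaw_start {S : Type*} [MeasurableSpace S] [MeasurableSingletonClass S]
    (P : Kernel S S) [IsMarkovKernel P] (i : S) :
    ∀ᵐ x ∂(pathLaw P i), x 0 = i := by
  let y : (k : Finset.Iic 0) → (fun _ : ℕ => S) k := fun _ => i
  have h : (pathLaw P i).map (Preorder.frestrictLe (π := fun _ : ℕ => S) 0) = Measure.dirac y := by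
    unfold pathLaw
    rw [Kernel.traj_map_frestrictLe_apply, Kernel.partialTraj_self, Kernel.id_apply]
  have h' : ∀ᵐ z ∂((pathLaw P i).map (Preorder.frestrictLe (π := fun _ : ℕ => S) 0)),
      z = y := by
    rw [h, ae_dirac_eq]; rfl
  filter_upwards [ae_of_ae_map (Preorder.measurable_frestrictLe 0).aemeasurable h'] with x hx
  exact congrFun hx ⟨0, by simp⟩

/-! ### The Markov property for events of the past, and hitting probabilities. -/

section Markov

variable {S : Type*} [Countable S] [MeasurableSpace S] [MeasurableSingletonClass S]
  {Ω : Type*} [MeasurableSpace Ω] {μ : Measure Ω} {P : Kernel S S} {X : ℕ → Ω → S}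

theorem measure_eq_tsum_inter_fiber {T : Type*} [Countable T] [MeasurableSpace T]
    [MeasurableSingletonClass T] (μ : Measure Ω) {f : Ω → T} (hf : Measurable f) (E : Set Ω) :
    μ E = ∑' t, μ (E ∩ f ⁻¹' {t}) := by
  have h := tsum_measure_preimage_singleton (μ := μ.restrict E) (s := Set.univ) (f := f)
    Set.countable_univ (fun y _ => hf (measurableSet_singleton y))
  rw [tsum_univ (fun t => μ.restrict E (f ⁻¹' {t})), Set.preimage_univ,
    Measure.restrict_apply_univ] at h
  rw [← h]
  refine tsum_congr fun t => ?_
  rw [Measure.restrict_apply (hf (measurableSet_singleton t)), Set.inter_comm]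

/-- The event `E` is determined by `X 0, …, X n`. -/
def DependsOnPast (X : ℕ → Ω → S) (n : ℕ) (E : Set Ω) : Prop :=
  ∀ ⦃ω ω'⦄, (∀ k ≤ n, X k ω = X k ω') → ω ∈ E → ω' ∈ E

/-- Such an event is the preimage of a subset of the countable space of histories, where every set
is measurable. -/
theorem DependsOnPast.measurableSet (hX : ∀ n, Measurable (X n)) {n : ℕ} {E : Set Ω}
    (hE : DependsOnPast X n E) : MeasurableSet E := by
  let f : Ω → (Finset.Iic n → S) := fun ω k => X k ω
  have hf : Measurable f := measurable_pi_lambda _ fun k => hX k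
  have : E = f ⁻¹' (f '' E) := by
    refine (Set.subset_preimage_image f E).antisymm ?_
    rintro ω' ⟨ω, hω, h⟩
    exact hE (fun k hk => congrFun h ⟨k, Finset.mem_Iic.2 hk⟩) hω
  rw [this]
  exact hf (Set.to_countable _).measurableSet

/-- Splits `F` into countably many cylinders of full histories; the Markov hypothesis applies to
those of positive measure, and null ones contribute 0 to both sides. -/
theorem IsMarkovChain.measure_inter_next [IsFiniteMeasure μ] (hX : IsMarkovChain μ P X) {n : ℕ}
    {F : Set Ω} (hF : DependsOnPast X n F) {i : S} (hi : ∀ ω ∈ F, X n ω = i) (j : S) :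
    μ (F ∩ {ω | X (n + 1) ω = j}) = μ F * P i {j} := by
  let f : Ω → (Finset.Iic n → S) := fun ω k => X k ω
  have hf : Measurable f := measurable_pi_lambda _ fun k => hX.measurable k
  rw [measure_eq_tsum_inter_fiber μ hf, measure_eq_tsum_inter_fiber μ hf F, ← ENNReal.tsum_mul_right]
  refine tsum_congr fun t => ?_
  rw [Set.inter_right_comm]
  rcases (F ∩ f ⁻¹' {t}).eq_empty_or_nonempty with h | ⟨ω₀, hω₀, rfl⟩
  · simp [h]
  have key : F ∩ f ⁻¹' {f ω₀} = {ω | ∀ k ≤ n, X k ω = X k ω₀} := by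
    ext ω
    constructor
    · rintro ⟨-, h⟩ k hk
      exact congrFun h ⟨k, Finset.mem_Iic.2 hk⟩
    · intro h
      exact ⟨hF (fun k hk => (h k hk).symm) hω₀,
        funext fun k => h k (Finset.mem_Iic.1 k.2)⟩
  have hm : MeasurableSet {ω | ∀ k ≤ n, X k ω = X k ω₀} := by
    refine DependsOnPast.measurableSet hX.measurable (n := n) ?_
    intro ω ω' h h' k hk
    rw [← h k hk, h' k hk]
  rw [key]
  by_cases h0 : μ {ω | ∀ k ≤ n, X k ω = X k ω₀} = 0
  · rw [h0, zero_mul]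
    exact measure_mono_null Set.inter_subset_left h0
  have := hX.markov n (fun k => X k ω₀) j h0
  rw [cond_apply hm] at this
  rw [← hi ω₀ hω₀, ← this, ← mul_assoc, ENNReal.mul_inv_cancel h0 (measure_ne_top _ _), one_mul]

/-- The probability, starting from `i`, that the first time `n ≥ 1` at `j` is `b + 1`. -/
noncomputable def hitProb (P : Kernel S S) (j : S) : ℕ → S → ℝ≥0∞
  | 0, i => P i {j}
  | b + 1, i => ∑' k, ({j}ᶜ : Set S).indicator (fun k => P i {k} * hitProb P j b k) k

/-- After time `s`, the next time at `j` is `s + b + 1`. -/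
def hitEvent (X : ℕ → Ω → S) (j : S) (s b : ℕ) : Set Ω :=
  {ω | X (s + b + 1) ω = j ∧ ∀ t, s < t → t < s + b + 1 → X t ω ≠ j}

/-- First-step analysis: split by the value `k` of `X (n + 1)`. The value `j` is excluded, and
otherwise `F ∩ {X (n + 1) = k}` is a past event at time `n + 1`, so the induction must keep `n`, `F`
and `i` general. -/
theorem IsMarkovChain.measure_inter_hitEvent [IsFiniteMeasure μ] (hX : IsMarkovChain μ P X) (j : S)
    (b : ℕ) : ∀ {n : ℕ} {F : Set Ω} {i : S}, DependsOnPast X n F → (∀ ω ∈ F, X n ω = i) →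
      μ (F ∩ hitEvent X j n b) = μ F * hitProb P j b i := by
  induction b with
  | zero =>
    intro n F i hF hi
    have : hitEvent X j n 0 = {ω | X (n + 1) ω = j} := by
      ext ω
      simp only [hitEvent, Set.mem_ofPred_eq, add_zero, and_iff_left_iff_imp]
      intro _ t h1 h2
      omega
    rw [this, hX.measure_inter_next hF hi]
    rfl
  | succ b ih =>
    intro n F i hF hi
    rw [measure_eq_tsum_inter_fiber μ (hX.measurable (n + 1))]
    rw [hitProb, ← ENNReal.tsum_mul_left]
    refine tsum_congr fun k => ?_
    by_cases hk : k = j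
    · subst hk
      have : F ∩ hitEvent X k n (b + 1) ∩ X (n + 1) ⁻¹' {k} = ∅ := by
        ext ω
        simp only [hitEvent, Set.mem_inter_iff, Set.mem_ofPred_eq, Set.mem_preimage,
          Set.mem_singleton_iff, Set.mem_empty_iff_false, iff_false, not_and]
        rintro ⟨-, -, h⟩ h'
        exact h (n + 1) (by omega) (by omega) h'
      simp [this]
    have : F ∩ hitEvent X j n (b + 1) ∩ X (n + 1) ⁻¹' {k} =
        (F ∩ {ω | X (n + 1) ω = k}) ∩ hitEvent X j (n + 1) b := by
      ext ω
      simp only [hitEvent, Set.mem_inter_iff, Set.mem_ofPred_eq, Set.mem_preimage,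
        Set.mem_singleton_iff]
      have e : n + (b + 1) + 1 = n + 1 + b + 1 := by omega
      rw [e]
      constructor
      · rintro ⟨⟨h1, h2, h3⟩, h4⟩
        exact ⟨⟨h1, h4⟩, h2, fun t ht ht' => h3 t (by omega) ht'⟩
      · rintro ⟨⟨h1, h4⟩, h2, h3⟩
        refine ⟨⟨h1, h2, fun t ht ht' => ?_⟩, h4⟩
        rcases (Nat.succ_le_of_lt ht).eq_or_lt with h | h
        · subst h; exact h4.trans_ne hk
        · exact h3 t h ht'
    rw [this, ih (i := k), hX.measure_inter_next hF hi, Set.indicator_of_mem (by simpa using hk),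
      mul_assoc]
    · rintro ω ω' h ⟨h1, h2⟩
      exact ⟨hF (fun k hk => h k (by omega)) h1, (h (n + 1) le_rfl).symm.trans h2⟩
    · exact fun ω h => h.2

theorem isMarkovChain_pathLaw (P : Kernel S S) [IsMarkovKernel P] (i : S) :
    IsMarkovChain (pathLaw P i) P (fun n x => x n) where
  measurable n := measurable_pi_apply n
  markov n x j h0 := by
    have hm : MeasurableSet {ω : ℕ → S | ∀ k ≤ n, ω k = x k} := by
      refine DependsOnPast.measurableSet (X := fun n (x : ℕ → S) => x n)
        (fun n => measurable_pi_apply n) (n := n) ?_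
      intro ω ω' h h' k hk
      exact (h k hk).symm.trans (h' k hk)
    have hmj : MeasurableSet {ω : ℕ → S | ω (n + 1) = j} :=
      (measurable_pi_apply (n + 1) : Measurable fun ω : ℕ → S => ω (n + 1))
        (measurableSet_singleton j)
    suffices h : pathLaw P i ({ω | ∀ k ≤ n, ω k = x k} ∩ {ω | ω (n + 1) = j}) =
        pathLaw P i {ω | ∀ k ≤ n, ω k = x k} * P (x n) {j} by
      rw [cond_apply hm, h, ← mul_assoc, ENNReal.inv_mul_cancel h0 (measure_ne_top _ _), one_mul]
    have hcomp := Kernel.traj_comp_partialTraj (X := fun _ : ℕ => S) (κ := stepKernel P)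
      (Nat.zero_le n)
    let y : (k : Finset.Iic n) → (fun _ : ℕ => S) k := fun k => x k
    have hpre : {ω : ℕ → S | ∀ k ≤ n, ω k = x k} =
        (Preorder.frestrictLe (π := fun _ : ℕ => S) n) ⁻¹' {y} := by
      ext ω
      simp only [Set.mem_ofPred_eq, Set.mem_preimage, Set.mem_singleton_iff]
      exact ⟨fun h => funext fun k => h k (Finset.mem_Iic.1 k.2),
        fun h k hk => congrFun h ⟨k, Finset.mem_Iic.2 hk⟩⟩
    -- Restarted from a history up to time `n`, the trajectory keeps that history, so the cylinder
    -- has probability 0 or 1.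
    have hdet : ∀ z : (k : Finset.Iic n) → (fun _ : ℕ => S) k,
        Kernel.traj (X := fun _ : ℕ => S) (stepKernel P) n z {ω | ∀ k ≤ n, ω k = x k} =
          ({y} : Set _).indicator 1 z := by
      intro z
      rw [hpre, ← Measure.map_apply (Preorder.measurable_frestrictLe n) (measurableSet_singleton y),
        Kernel.traj_map_frestrictLe_apply, Kernel.partialTraj_self, Kernel.id_apply,
        Measure.dirac_apply]
    have hnext : Kernel.traj (X := fun _ : ℕ => S) (stepKernel P) n y {ω | ω (n + 1) = j} =
        P (x n) {j} := by
      have h := Kernel.map_traj_succ_self (X := fun _ : ℕ => S) (κ := stepKernel P) (a := n)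
      have h2 := DFunLike.congr_fun h y
      rw [Kernel.map_apply _ (measurable_pi_apply _)] at h2
      have h3 := congrArg (fun m => m {j}) h2
      simp only at h3
      rw [Measure.map_apply (measurable_pi_apply _) (measurableSet_singleton j)] at h3
      exact h3
    unfold pathLaw
    rw [← hcomp, Kernel.comp_apply' _ _ _ (hm.inter hmj), Kernel.comp_apply' _ _ _ hm,
      ← lintegral_mul_const _ (Kernel.measurable_coe _ hm)]
    refine lintegral_congr fun z => ?_
    rw [hdet]
    by_cases hz : z = y
    · subst hz
      have hone : Kernel.traj (X := fun _ : ℕ => S) (stepKernel P) n y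
          {ω | ∀ k ≤ n, ω k = x k} = 1 := by rw [hdet]; simp
      rw [← hnext]
      have hae : ∀ᵐ ω ∂(Kernel.traj (X := fun _ : ℕ => S) (stepKernel P) n y),
          ω ∈ {ω : ℕ → S | ∀ k ≤ n, ω k = x k} := by
        exact (mem_ae_iff_prob_eq_one hm).2 hone
      rw [Measure.measure_inter_eq_of_ae hae]
      simp
    · rw [Set.indicator_of_notMem (by simpa using hz), zero_mul]
      refine measure_mono_null Set.inter_subset_left ?_
      rw [hdet, Set.indicator_of_notMem (by simpa using hz)]

theorem pathLaw_hitEvent (P : Kernel S S) [IsMarkovKernel P] (j : S) (b : ℕ) :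
    pathLaw P j (hitEvent (fun n x => x n) j 0 b) = hitProb P j b j := by
  have h := (isMarkovChain_pathLaw P j).measure_inter_hitEvent j b (n := 0) (F := {x | x 0 = j})
    (i := j) (fun ω ω' h h' => (h 0 le_rfl).symm.trans h') (fun ω h => h)
  have h1 : pathLaw P j {x | x 0 = j} = 1 := by
    have hm : MeasurableSet {x : ℕ → S | x 0 = j} :=
      (measurable_pi_apply 0 : Measurable fun x : ℕ → S => x 0) (measurableSet_singleton j)
    exact (mem_ae_iff_prob_eq_one hm).1 (pathLaw_start P j)
  have hae : ∀ᵐ x ∂(pathLaw P j), x ∈ {x : ℕ → S | x 0 = j} := pathLaw_start P j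
  rwa [h1, one_mul, Measure.measure_inter_eq_of_ae hae] at h

end Markov

/-! ### Visits and gaps along a fixed path. -/

section Visits

variable {S : Type*} {Ω : Type*} {X : ℕ → Ω → S} {j : S}

open Classical in
/-- At time `s` the sequence is at `j`, having been there exactly `k` times before. -/
def visitAt (X : ℕ → Ω → S) (j : S) (k s : ℕ) : Set Ω :=
  {ω | X s ω = j ∧ Nat.count (fun n => X n ω = j) s = k}

/-- The sequence is at `j` at least `k + 1` times. -/
def visits (X : ℕ → Ω → S) (j : S) (k : ℕ) : Set Ω := ⋃ s, visitAt X j k s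

/-- The visit to `j` with index `k` is followed by another one after exactly `b + 1` steps. -/
def gapEvent (X : ℕ → Ω → S) (j : S) (k b : ℕ) : Set Ω := ⋃ s, visitAt X j k s ∩ hitEvent X j s b

/-- The number of steps strictly between the visits to `j` with indices `k` and `k + 1`. -/
noncomputable def gap (X : ℕ → Ω → S) (j : S) (k : ℕ) (ω : Ω) : ℕ :=
  Nat.nth (fun n => X n ω = j) (k + 1) - Nat.nth (fun n => X n ω = j) k - 1

theorem visitAt_unique {k s t : ℕ} {ω : Ω} (hs : ω ∈ visitAt X j k s) (ht : ω ∈ visitAt X j k t) :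
    s = t := by
  classical
  refine Nat.count_injective (p := fun n => X n ω = j) hs.1 ht.1 ?_
  convert hs.2.trans ht.2.symm

theorem hitEvent_unique {s a b : ℕ} {ω : Ω} (ha : ω ∈ hitEvent X j s a)
    (hb : ω ∈ hitEvent X j s b) : a = b := by
  by_contra h
  rcases lt_or_gt_of_ne h with h | h
  · exact hb.2 (s + a + 1) (by omega) (by omega) ha.1
  · exact ha.2 (s + b + 1) (by omega) (by omega) hb.1

open Classical in
theorem visitAt_succ_of_hitEvent {k s b : ℕ} {ω : Ω} (hs : ω ∈ visitAt X j k s)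
    (hb : ω ∈ hitEvent X j s b) : ω ∈ visitAt X j (k + 1) (s + b + 1) := by
  refine ⟨hb.1, ?_⟩
  have h : ∀ c ≤ b, Nat.count (fun n => X n ω = j) (s + c + 1) = k + 1 := by
    intro c
    induction c with
    | zero =>
      intro _
      rw [add_zero, Nat.count_succ, hs.2, if_pos hs.1]
    | succ c ih =>
      intro hc
      rw [Nat.count_succ, show s + (c + 1) = s + c + 1 by omega, ih (by omega),
        if_neg (hb.2 _ (by omega) (by omega))]
  exact h b le_rfl

open Classical in
theorem exists_hitEvent_of_visitAt {s t : ℕ} {ω : Ω} (hst : s < t) (ht : X t ω = j) :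
    ∃ b, ω ∈ hitEvent X j s b := by
  have hex : ∃ b, X (s + b + 1) ω = j := ⟨t - s - 1, by
    rwa [show s + (t - s - 1) + 1 = t by omega]⟩
  refine ⟨Nat.find hex, Nat.find_spec hex, fun u h1 h2 hu => ?_⟩
  refine Nat.find_min hex (m := u - s - 1) (by omega) ?_
  rwa [show s + (u - s - 1) + 1 = u by omega]

theorem visitAt_lt {k l s t : ℕ} {ω : Ω} (hs : ω ∈ visitAt X j k s) (ht : ω ∈ visitAt X j l t)
    (h : k < l) : s < t := by
  classical
  refine Nat.lt_of_count_lt_count (p := fun n => X n ω = j) ?_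
  have h1 := hs.2
  have h2 := ht.2
  convert h

open Classical in
theorem mem_visits_of_succ {k : ℕ} {ω : Ω} (h : ω ∈ visits X j (k + 1)) : ω ∈ visits X j k := by
  obtain ⟨t, ht⟩ := Set.mem_iUnion.1 h
  refine Set.mem_iUnion.2 ⟨Nat.nth (fun n => X n ω = j) k, ?_⟩
  have hc : k < Nat.count (fun n => X n ω = j) t := by rw [ht.2]; omega
  -- `Nat.nth` takes the default value 0 beyond the size of a finite set, so a visit of index `k`
  -- must be known to exist.
  have hcard : ∀ hf : (Set.ofPred fun n => X n ω = j).Finite, k < hf.toFinset.card :=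
    fun hf => hc.trans_le (Nat.count_le_card hf t)
  exact ⟨Nat.nth_mem k hcard, Nat.count_nth hcard⟩

theorem visits_succ_eq (k : ℕ) : visits X j (k + 1) = ⋃ b, gapEvent X j k b := by
  ext ω
  constructor
  · intro h
    obtain ⟨s, hs⟩ := Set.mem_iUnion.1 (mem_visits_of_succ h)
    obtain ⟨t, ht⟩ := Set.mem_iUnion.1 h
    obtain ⟨b, hb⟩ := exists_hitEvent_of_visitAt (visitAt_lt hs ht (Nat.lt_succ_self k)) ht.1
    exact Set.mem_iUnion.2 ⟨b, Set.mem_iUnion.2 ⟨s, hs, hb⟩⟩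
  · intro h
    obtain ⟨b, h⟩ := Set.mem_iUnion.1 h
    obtain ⟨s, hs, hb⟩ := Set.mem_iUnion.1 h
    exact Set.mem_iUnion.2 ⟨_, visitAt_succ_of_hitEvent hs hb⟩

theorem disjoint_gapEvent (k : ℕ) : Pairwise (Function.onFun Disjoint (gapEvent X j k)) := by
  intro a b hab
  refine Set.disjoint_left.2 fun ω ha hb => hab ?_
  obtain ⟨s, hs, ha⟩ := Set.mem_iUnion.1 ha
  obtain ⟨t, ht, hb⟩ := Set.mem_iUnion.1 hb
  obtain rfl := visitAt_unique hs ht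
  exact hitEvent_unique ha hb

open Classical in
theorem visits_zero : visits X j 0 = visitEvent X j := by
  ext ω
  constructor
  · intro h
    obtain ⟨s, hs⟩ := Set.mem_iUnion.1 h
    exact ⟨s, hs.1⟩
  · intro (h : ∃ l, X l ω = j)
    refine Set.mem_iUnion.2 ⟨Nat.find h, Nat.find_spec h, ?_⟩
    exact Nat.count_iff_forall_not.2 fun m hm => Nat.find_min h hm

theorem visits_subset_visitEvent (k : ℕ) :
    visits X j k ⊆ visitEvent X j := by
  intro ω h
  obtain ⟨s, hs⟩ := Set.mem_iUnion.1 h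
  exact ⟨s, hs.1⟩

theorem gapEvent_subset_visitEvent (k b : ℕ) :
    gapEvent X j k b ⊆ visitEvent X j := by
  intro ω h
  obtain ⟨s, hs, -⟩ := Set.mem_iUnion.1 h
  exact ⟨s, hs.1⟩

theorem infinite_iff_visits {ω : Ω} :
    (Set.ofPred fun n => X n ω = j).Infinite ↔ ∀ k, ω ∈ visits X j k := by
  classical
  constructor
  · intro h k
    refine Set.mem_iUnion.2 ⟨Nat.nth (fun n => X n ω = j) k, Nat.nth_mem_of_infinite h k, ?_⟩
    convert Nat.count_nth_of_infinite h k
  · intro h hf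
    obtain ⟨s, hs⟩ := Set.mem_iUnion.1 (h hf.toFinset.card)
    have := Nat.count_lt_card hf hs.1
    have h2 := hs.2
    refine this.ne ?_
    convert h2

theorem mem_gapEvent_iff {k b : ℕ} {ω : Ω} (h : (Set.ofPred fun n => X n ω = j).Infinite) :
    ω ∈ gapEvent X j k b ↔ gap X j k ω = b := by
  classical
  have key : ∀ a, ω ∈ gapEvent X j k a → gap X j k ω = a := by
    intro a ha
    obtain ⟨s, hs, ha⟩ := Set.mem_iUnion.1 ha
    have h1 : Nat.nth (fun n => X n ω = j) k = s := by
      rw [← hs.2]; exact Nat.nth_count hs.1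
    have hs' := visitAt_succ_of_hitEvent hs ha
    have h2 : Nat.nth (fun n => X n ω = j) (k + 1) = s + a + 1 := by
      rw [← hs'.2]; exact Nat.nth_count hs'.1
    rw [gap, h1, h2]
    omega
  refine ⟨key b, fun hb => ?_⟩
  have := infinite_iff_visits.1 h (k + 1)
  rw [visits_succ_eq] at this
  obtain ⟨a, ha⟩ := Set.mem_iUnion.1 this
  rwa [← hb, key a ha]

theorem sum_gap {ω : Ω} (h : (Set.ofPred fun n => X n ω = j).Infinite) (n : ℕ) :
    ∑ k ∈ Finset.range n, (gap X j k ω + 1) + Nat.nth (fun n => X n ω = j) 0 =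
      Nat.nth (fun n => X n ω = j) n := by
  induction n with
  | zero => simp
  | succ n ih =>
    have := Nat.nth_strictMono h (Nat.lt_succ_self n)
    rw [Finset.sum_range_succ, gap]
    simp only [Nat.succ_eq_add_one] at this
    omega

theorem dependsOnPast_visitAt (k s : ℕ) : DependsOnPast X s (visitAt X j k s) := by
  classical
  intro ω ω' h hω
  refine ⟨(h s le_rfl).symm.trans hω.1, ?_⟩
  rw [← hω.2, Nat.count_eq_card_filter_range, Nat.count_eq_card_filter_range]
  congr 1
  refine Finset.filter_congr fun n hn => ?_
  rw [h n (Finset.mem_range.1 hn).le]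

theorem dependsOnPast_hitEvent (s b : ℕ) : DependsOnPast X (s + b + 1) (hitEvent X j s b) := by
  intro ω ω' h hω
  exact ⟨(h _ le_rfl).symm.trans hω.1, fun t h1 h2 => (h t h2.le) ▸ hω.2 t h1 h2⟩

theorem DependsOnPast.mono {m n : ℕ} (hmn : m ≤ n) {E : Set Ω} (hE : DependsOnPast X m E) :
    DependsOnPast X n E :=
  fun _ _ h => hE fun k hk => h k (hk.trans hmn)

theorem DependsOnPast.inter {n : ℕ} {E F : Set Ω} (hE : DependsOnPast X n E)
    (hF : DependsOnPast X n F) : DependsOnPast X n (E ∩ F) :=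
  fun _ _ h hω => ⟨hE h hω.1, hF h hω.2⟩

/-- The gap of index `i` ends at the visit of index `i + 1 ≤ k`, hence no later than `s`. This puts
earlier gaps in the past of the visit of index `k`, which yields independence. -/
theorem dependsOnPast_gapEvent_inter {i k : ℕ} (hik : i < k) (a s : ℕ) :
    DependsOnPast X s (gapEvent X j i a ∩ visitAt X j k s) := by
  rintro ω ω' h ⟨h1, h2⟩
  refine ⟨?_, dependsOnPast_visitAt k s h h2⟩
  obtain ⟨t, ht, ha⟩ := Set.mem_iUnion.1 h1
  have h3 := visitAt_succ_of_hitEvent ht ha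
  have hle : t + a + 1 ≤ s := by
    rcases (Nat.succ_le_of_lt hik).eq_or_lt with e | e
    · subst e; exact (visitAt_unique h3 h2).le
    · exact (visitAt_lt h3 h2 e).le
  exact Set.mem_iUnion.2 ⟨t, (dependsOnPast_visitAt i t).mono (by omega) h ht,
    (dependsOnPast_hitEvent t a).mono hle h ha⟩

end Visits

/-! ### The strong Markov property at visit times. -/

section StrongMarkov

variable {S : Type*} [Countable S] [MeasurableSpace S] [MeasurableSingletonClass S]
  {Ω : Type*} [MeasurableSpace Ω] {μ : Measure Ω} {P : Kernel S S} {X : ℕ → Ω → S}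

theorem measurableSet_visits (hX : ∀ n, Measurable (X n)) (j : S) (k : ℕ) :
    MeasurableSet (visits X j k) :=
  MeasurableSet.iUnion fun s => (dependsOnPast_visitAt k s).measurableSet hX

theorem measurableSet_gapEvent (hX : ∀ n, Measurable (X n)) (j : S) (k b : ℕ) :
    MeasurableSet (gapEvent X j k b) :=
  MeasurableSet.iUnion fun s => ((dependsOnPast_visitAt k s).measurableSet hX).inter
    ((dependsOnPast_hitEvent s b).measurableSet hX)

/-- `hE` says that `E` belongs to the past of the random time of the visit of index `k`; the Markov
property is applied on each piece where that time equals `s`. -/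
theorem IsMarkovChain.measure_inter_gapEvent [IsFiniteMeasure μ] (hX : IsMarkovChain μ P X) (j : S)
    {k : ℕ} {E : Set Ω} (hE : ∀ s, DependsOnPast X s (E ∩ visitAt X j k s)) (b : ℕ) :
    μ (E ∩ gapEvent X j k b) = μ (E ∩ visits X j k) * hitProb P j b j := by
  have hdisj : Pairwise (Function.onFun Disjoint fun s => E ∩ visitAt X j k s) := fun s t hst =>
    Set.disjoint_left.2 fun ω h1 h2 => hst (visitAt_unique h1.2 h2.2)
  have hm : ∀ s, MeasurableSet (E ∩ visitAt X j k s) := fun s => (hE s).measurableSet hX.measurable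
  rw [gapEvent, visits, Set.inter_iUnion, Set.inter_iUnion, measure_iUnion hdisj hm,
    ← ENNReal.tsum_mul_right, measure_iUnion]
  · refine tsum_congr fun s => ?_
    rw [← Set.inter_assoc, hX.measure_inter_hitEvent j b (hE s) fun ω h => h.2.1]
  · have hsub : ∀ s, E ∩ (visitAt X j k s ∩ hitEvent X j s b) ⊆ E ∩ visitAt X j k s :=
      fun s ω h => ⟨h.1, h.2.1⟩
    exact fun s t hst => (hdisj hst).mono (hsub s) (hsub t)
  · intro s
    rw [← Set.inter_assoc]
    exact (hm s).inter ((dependsOnPast_hitEvent s b).measurableSet hX.measurable)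

theorem IsMarkovChain.measure_gapEvent [IsFiniteMeasure μ] (hX : IsMarkovChain μ P X) (j : S)
    (k b : ℕ) : μ (gapEvent X j k b) = μ (visits X j k) * hitProb P j b j := by
  have := hX.measure_inter_gapEvent j (k := k) (E := Set.univ)
    (fun s => by simpa using dependsOnPast_visitAt k s) b
  simpa using this

theorem IsMarkovChain.measure_visits_succ [IsFiniteMeasure μ] (hX : IsMarkovChain μ P X) (j : S)
    (k : ℕ) : μ (visits X j (k + 1)) = μ (visits X j k) * ∑' b, hitProb P j b j := by
  rw [visits_succ_eq, measure_iUnion (disjoint_gapEvent k)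
    fun b => measurableSet_gapEvent hX.measurable j k b, ← ENNReal.tsum_mul_left]
  exact tsum_congr fun b => hX.measure_gapEvent j k b

theorem measurable_nth (hX : ∀ n, Measurable (X n)) (j : S) (k : ℕ) :
    Measurable fun ω => Nat.nth (fun n => X n ω = j) k := by
  classical
  have hpos : ∀ s : ℕ, s ≠ 0 →
      MeasurableSet ((fun ω => Nat.nth (fun n => X n ω = j) k) ⁻¹' {s}) := by
    intro s hs
    have : (fun ω => Nat.nth (fun n => X n ω = j) k) ⁻¹' {s} = visitAt X j k s := by
      ext ω
      constructor
      · intro (h : Nat.nth (fun n => X n ω = j) k = s)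
        have h0 : Nat.nth (fun n => X n ω = j) k ≠ 0 := h ▸ hs
        refine ⟨h ▸ Nat.nth_mem_of_ne_zero h0, ?_⟩
        rw [← h]
        convert Nat.count_nth (Nat.lt_card_toFinset_of_nth_ne_zero h0)
      · intro h
        have h2 := h.2
        change Nat.nth (fun n => X n ω = j) k = s
        rw [← h2]
        exact Nat.nth_count h.1
    rw [this]
    exact (dependsOnPast_visitAt k s).measurableSet hX
  refine measurable_to_countable' fun s => ?_
  rcases eq_or_ne s 0 with rfl | hs
  -- The value 0 is either a genuine visit or the default of `Nat.nth`, so its fibre is taken as the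
  -- complement of the others.
  · have : (fun ω => Nat.nth (fun n => X n ω = j) k) ⁻¹' {0} =
        (⋃ s : ℕ, (fun ω => Nat.nth (fun n => X n ω = j) k) ⁻¹' {s + 1})ᶜ := by
      ext ω
      simp only [Set.mem_preimage, Set.mem_singleton_iff, Set.mem_compl_iff, Set.mem_iUnion,
        not_exists]
      constructor
      · intro h s
        omega
      · intro h
        by_contra h0
        exact h _ (Nat.succ_pred_eq_of_ne_zero h0).symm
    rw [this]
    exact (MeasurableSet.iUnion fun s => hpos _ s.succ_ne_zero).compl
  · exact hpos s hs

theorem measurable_gap (hX : ∀ n, Measurable (X n)) (j : S) (k : ℕ) : Measurable (gap X j k) :=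
  ((measurable_nth hX j (k + 1)).sub (measurable_nth hX j k)).sub measurable_const

end StrongMarkov

/-! ### From occurrence times to frequencies. -/

/-- With N occurrences before `n`, `nth (N - 1) < n ≤ nth N`, so N / n lies between N / `nth N` and
N / `nth (N - 1)`. -/
theorem tendsto_count_div {p : ℕ → Prop} [DecidablePred p] (hp : (Set.ofPred p).Infinite) {L : ℝ}
    (h : Tendsto (fun k : ℕ => (k : ℝ) / Nat.nth p k) atTop (𝓝 L)) :
    Tendsto (fun n : ℕ => (Nat.count p n : ℝ) / n) atTop (𝓝 L) := by
  have hcount : Tendsto (Nat.count p) atTop atTop := by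
    refine tendsto_atTop.2 fun k => ?_
    filter_upwards [eventually_ge_atTop (Nat.nth p k)] with n hn
    calc k = Nat.count p (Nat.nth p k) := (Nat.count_nth_of_infinite hp k).symm
      _ ≤ Nat.count p n := Nat.count_monotone p hn
  have hnth : Tendsto (fun k => (Nat.nth p k : ℝ)) atTop atTop :=
    tendsto_natCast_atTop_atTop.comp (Nat.nth_strictMono hp).tendsto_atTop
  have hupper : Tendsto (fun k : ℕ => ((k : ℝ) + 1) / Nat.nth p k) atTop (𝓝 L) := by
    simpa [add_div] using h.add (tendsto_inv_atTop_zero.comp hnth)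
  have hpred : Tendsto (fun n => Nat.count p n - 1) atTop atTop :=
    (tendsto_sub_atTop_nat 1).comp hcount
  refine tendsto_of_tendsto_of_tendsto_of_le_of_le' (h.comp hcount) (hupper.comp hpred) ?_ ?_
  · filter_upwards [eventually_gt_atTop 0] with n hn
    have : n ≤ Nat.nth p (Nat.count p n) := Nat.le_nth_count hp n
    have hn' : (0 : ℝ) < n := by exact_mod_cast hn
    simp only [Function.comp_apply]
    gcongr
  -- Two occurrences force `nth (N - 1) ≥ N - 1 ≥ 1`, a positive denominator.
  · filter_upwards [hcount.eventually_ge_atTop 2] with n hn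
    have h1 : Nat.nth p (Nat.count p n - 1) < n := Nat.nth_lt_of_lt_count (by omega)
    have h2 : 0 < Nat.nth p (Nat.count p n - 1) :=
      lt_of_lt_of_le (by omega) (Nat.le_nth fun hf => absurd hf hp : Nat.count p n - 1 ≤ _)
    have h2' : (0 : ℝ) < Nat.nth p (Nat.count p n - 1) := by exact_mod_cast h2
    have h3 : ((Nat.count p n - 1 : ℕ) : ℝ) + 1 = Nat.count p n := by
      rw [Nat.cast_sub (by omega)]; simp
    simp only [Function.comp_apply]
    rw [h3]
    gcongr

theorem tendsto_count_div_of_finite {p : ℕ → Prop} [DecidablePred p]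
    (hp : (Set.ofPred p).Finite) :
    Tendsto (fun n : ℕ => (Nat.count p n : ℝ) / n) atTop (𝓝 0) := by
  refine squeeze_zero (fun n => by positivity) (fun n => ?_)
    (tendsto_const_div_atTop_nhds_zero_nat (hp.toFinset.card : ℝ))
  have := Nat.count_le_card hp n
  gcongr

/-! ### The renewal strong law. -/

section Renewal

variable {Ω : Type*} [MeasurableSpace Ω] {ν : Measure Ω} [IsProbabilityMeasure ν]

theorem indepFun_of_measure_inter_fiber {f g : Ω → ℕ} (hf : Measurable f) (hg : Measurable g)
    (h : ∀ a b, ν (f ⁻¹' {a} ∩ g ⁻¹' {b}) = ν (f ⁻¹' {a}) * ν (g ⁻¹' {b})) :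
    IndepFun f g ν := by
  have : IsProbabilityMeasure (ν.map f) := Measure.isProbabilityMeasure_map hf.aemeasurable
  have : IsProbabilityMeasure (ν.map g) := Measure.isProbabilityMeasure_map hg.aemeasurable
  rw [indepFun_iff_map_prod_eq_prod_map_map hf.aemeasurable hg.aemeasurable]
  refine Measure.ext_of_singleton fun ⟨a, b⟩ => ?_
  rw [Measure.map_apply (hf.prodMk hg) (measurableSet_singleton _), ← Set.singleton_prod_singleton,
    Measure.prod_prod, Measure.map_apply hf (measurableSet_singleton _),
    Measure.map_apply hg (measurableSet_singleton _), ← h, Set.mk_preimage_prod]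

/-- The renewal form of the strong law of large numbers; the mean may be infinite. -/
theorem ae_tendsto_div_sum {Y : ℕ → Ω → ℕ} (hpos : ∀ k ω, 1 ≤ Y k ω)
    (hindep : Pairwise fun i k => IndepFun (Y i) (Y k) ν)
    (hident : ∀ k, IdentDistrib (Y k) (Y 0) ν ν) :
    ∀ᵐ ω ∂ν, Tendsto (fun n : ℕ => (n : ℝ) / ∑ k ∈ Finset.range n, (Y k ω : ℝ)) atTop
      (𝓝 (∫⁻ ω, (Y 0 ω : ℝ≥0∞) ∂ν).toReal⁻¹) := by
  have hmeas : AEMeasurable (Y 0) ν := (hident 0).aemeasurable_fst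
  have slln : ∀ φ : ℕ → ℝ, Integrable (fun ω => φ (Y 0 ω)) ν → ∀ᵐ ω ∂ν,
      Tendsto (fun n : ℕ => (∑ k ∈ Finset.range n, φ (Y k ω)) / n) atTop
        (𝓝 (∫ ω, φ (Y 0 ω) ∂ν)) := fun φ hφ =>
    strong_law_ae_real (fun k ω => φ (Y k ω)) hφ
      (fun i k hik => (hindep hik).comp measurable_from_nat measurable_from_nat)
      fun k => (hident k).comp measurable_from_nat
  have hY : AEMeasurable (fun ω => (Y 0 ω : ℝ≥0∞)) ν :=
    measurable_from_nat.comp_aemeasurable hmeas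
  have hinv : ∀ ω (n : ℕ), ((∑ k ∈ Finset.range n, (Y k ω : ℝ)) / n)⁻¹ =
      (n : ℝ) / ∑ k ∈ Finset.range n, (Y k ω : ℝ) := fun ω n => inv_div _ _
  by_cases htop : ∫⁻ ω, (Y 0 ω : ℝ≥0∞) ∂ν = ∞
  · rw [htop, ENNReal.toReal_top, inv_zero]
    -- With infinite mean, averages dominate those of the truncations at `K`, whose means increase
    -- to ∞ by monotone convergence.
    have htrunc : ∀ K : ℕ, ∀ᵐ ω ∂ν, Tendsto
        (fun n : ℕ => (∑ k ∈ Finset.range n, ((min (Y k ω) K : ℕ) : ℝ)) / n) atTop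
        (𝓝 (∫⁻ ω, ((min (Y 0 ω) K : ℕ) : ℝ≥0∞) ∂ν).toReal) := by
      intro K
      have hm : AEMeasurable (fun ω => ((min (Y 0 ω) K : ℕ) : ℝ≥0∞)) ν :=
        (measurable_from_nat (f := fun m : ℕ => ((min m K : ℕ) : ℝ≥0∞))).comp_aemeasurable hmeas
      have hint : Integrable (fun ω => ((min (Y 0 ω) K : ℕ) : ℝ)) ν := by
        refine Integrable.of_bound (C := K) ((measurable_from_nat
          (f := fun m : ℕ => ((min m K : ℕ) : ℝ))).comp_aemeasurable hmeas).aestronglyMeasurable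
          (ae_of_all _ fun ω => ?_)
        rw [Real.norm_natCast]
        exact_mod_cast min_le_right _ _
      have := slln (fun m => ((min m K : ℕ) : ℝ)) hint
      rw [← integral_toReal hm (ae_of_all _ fun ω => ENNReal.natCast_lt_top _)]
      simpa using this
    have hlim : Tendsto (fun K : ℕ => ∫⁻ ω, ((min (Y 0 ω) K : ℕ) : ℝ≥0∞) ∂ν) atTop (𝓝 ∞) := by
      rw [← htop]
      refine lintegral_tendsto_of_tendsto_of_monotone (fun K => ?_) (ae_of_all _ fun ω => ?_)
        (ae_of_all _ fun ω => ?_)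
      · exact (measurable_from_nat
          (f := fun m : ℕ => ((min m K : ℕ) : ℝ≥0∞))).comp_aemeasurable hmeas
      · intro K L hKL
        exact Nat.cast_le.2 (min_le_min le_rfl hKL)
      · refine tendsto_const_nhds.congr' ?_
        filter_upwards [eventually_ge_atTop (Y 0 ω)] with K hK
        rw [min_eq_left hK]
    filter_upwards [ae_all_iff.2 htrunc] with ω hω
    have : Tendsto (fun n : ℕ => (∑ k ∈ Finset.range n, (Y k ω : ℝ)) / n) atTop atTop := by
      refine tendsto_atTop.2 fun M => ?_
      obtain ⟨K, hK⟩ := (hlim.eventually_const_lt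
        (ENNReal.natCast_lt_top ⌈M⌉₊)).exists
      have hfin : ∫⁻ ω, ((min (Y 0 ω) K : ℕ) : ℝ≥0∞) ∂ν ≠ ∞ := by
        refine ne_top_of_le_ne_top (ENNReal.natCast_ne_top K) ?_
        calc _ ≤ ∫⁻ _, (K : ℝ≥0∞) ∂ν :=
              lintegral_mono fun ω => Nat.cast_le.2 (min_le_right _ _)
          _ = K := by simp
      have hM : M < (∫⁻ ω, ((min (Y 0 ω) K : ℕ) : ℝ≥0∞) ∂ν).toReal := by
        refine (Nat.le_ceil M).trans_lt ?_
        simpa using (ENNReal.toReal_lt_toReal (ENNReal.natCast_ne_top _) hfin).2 hK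
      filter_upwards [(hω K).eventually_const_lt hM] with n hn
      refine hn.le.trans ?_
      gcongr
      exact min_le_left _ _
    exact (tendsto_inv_atTop_zero.comp this).congr (hinv ω)
  · have hint : Integrable (fun ω => (Y 0 ω : ℝ)) ν := by
      have := integrable_toReal_of_lintegral_ne_top hY htop
      simpa using this
    have hval : ∫ ω, (Y 0 ω : ℝ) ∂ν = (∫⁻ ω, (Y 0 ω : ℝ≥0∞) ∂ν).toReal := by
      rw [← integral_toReal hY (ae_of_all _ fun ω => ENNReal.natCast_lt_top _)]
      simp
    have hne : (∫⁻ ω, (Y 0 ω : ℝ≥0∞) ∂ν).toReal ≠ 0 := by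
      refine (ENNReal.toReal_pos (fun h0 => ?_) htop).ne'
      have h1 : ∫⁻ _, 1 ∂ν ≤ ∫⁻ ω, (Y 0 ω : ℝ≥0∞) ∂ν :=
        lintegral_mono fun ω => Nat.one_le_cast.2 (hpos 0 ω)
      rw [h0] at h1
      simp at h1
    filter_upwards [slln (fun m => (m : ℝ)) hint] with ω hω
    rw [hval] at hω
    exact (hω.inv₀ hne).congr (hinv ω)

end Renewal

/-! ### The return time under the path law. -/

section Paths

variable {S : Type*}

theorem setOf_return_eq (j : S) : {x : ℕ → S | ∃ n : ℕ, 1 ≤ n ∧ x n = j} =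
    ⋃ b, hitEvent (fun n (x : ℕ → S) => x n) j 0 b := by
  ext x
  constructor
  · rintro ⟨n, hn, hx⟩
    exact Set.mem_iUnion.2 (exists_hitEvent_of_visitAt hn hx)
  · intro h
    obtain ⟨b, hb⟩ := Set.mem_iUnion.1 h
    exact ⟨0 + b + 1, by omega, hb.1⟩

theorem disjoint_hitEvent_path (j : S) :
    Pairwise (Function.onFun Disjoint (hitEvent (fun n (x : ℕ → S) => x n) j 0)) :=
  fun _ _ hab => Set.disjoint_left.2 fun _ ha hb => hab (hitEvent_unique ha hb)

theorem returnTime_of_hitEvent {j : S} {b : ℕ} {x : ℕ → S}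
    (hx : x ∈ hitEvent (fun n (x : ℕ → S) => x n) j 0 b) : returnTime j x = (b + 1 : ℕ) := by
  refine le_antisymm ?_ ?_
  · refine iInf₂_le (b + 1) ⟨by omega, ?_⟩
    simpa using hx.1
  · refine le_iInf₂ fun n hn => Nat.cast_le.2 ?_
    by_contra h
    exact hx.2 n (by omega) (by omega) hn.2

end Paths

section MeanRecurrenceTime

variable {S : Type*} [Countable S] [MeasurableSpace S] [MeasurableSingletonClass S]

theorem measurableSet_hitEvent_path (j : S) (b : ℕ) :
    MeasurableSet (hitEvent (fun n (x : ℕ → S) => x n) j 0 b) :=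
  (dependsOnPast_hitEvent 0 b).measurableSet fun n => measurable_pi_apply n

theorem tsum_hitProb (P : Kernel S S) [IsMarkovKernel P] (j : S) :
    ∑' b, hitProb P j b j = pathLaw P j {x | ∃ n : ℕ, 1 ≤ n ∧ x n = j} := by
  rw [setOf_return_eq, measure_iUnion (disjoint_hitEvent_path j) (measurableSet_hitEvent_path j)]
  exact tsum_congr fun b => (pathLaw_hitEvent P j b).symm

theorem isRecurrent_iff (P : Kernel S S) [IsMarkovKernel P] (j : S) :
    IsRecurrent P j ↔ ∑' b, hitProb P j b j = 1 := by
  rw [tsum_hitProb, ← mem_ae_iff_prob_eq_one]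
  · rfl
  · rw [setOf_return_eq]
    exact MeasurableSet.iUnion (measurableSet_hitEvent_path j)

/-- Recurrence discards the paths that never return, where `returnTime` is ∞ and which the series
does not see. -/
theorem IsRecurrent.meanRecurrenceTime_eq {P : Kernel S S} [IsMarkovKernel P] {j : S}
    (h : IsRecurrent P j) :
    meanRecurrenceTime P j = ∑' b : ℕ, ((b + 1 : ℕ) : ℝ≥0∞) * hitProb P j b j := by
  have hae : ∀ᵐ x ∂(pathLaw P j), x ∈ ⋃ b, hitEvent (fun n (x : ℕ → S) => x n) j 0 b := by
    rw [← setOf_return_eq]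
    exact h
  rw [meanRecurrenceTime, ← Measure.restrict_eq_self_of_ae_mem hae,
    lintegral_iUnion (measurableSet_hitEvent_path j) (disjoint_hitEvent_path j)]
  refine tsum_congr fun b => ?_
  rw [setLIntegral_congr_fun (measurableSet_hitEvent_path j b)
    (fun x hx => returnTime_of_hitEvent hx), setLIntegral_const, pathLaw_hitEvent]

end MeanRecurrenceTime

/-! ### The visit frequency of one state. -/

section Occupation

variable {S : Type*} [Countable S] [MeasurableSpace S] [MeasurableSingletonClass S]
  {Ω : Type*} [MeasurableSpace Ω] {μ : Measure Ω} [IsProbabilityMeasure μ]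
  {P : Kernel S S} [IsMarkovKernel P] {X : ℕ → Ω → S}

theorem IsMarkovChain.ae_finite_visits (hX : IsMarkovChain μ P X) {j : S}
    (hj : ¬ IsRecurrent P j) : ∀ᵐ ω ∂μ, (Set.ofPred fun n => X n ω = j).Finite := by
  set F := ∑' b, hitProb P j b j with hF
  have hF1 : F < 1 := by
    refine lt_of_le_of_ne ?_ fun h => hj ((isRecurrent_iff P j).2 h)
    rw [hF, tsum_hitProb]
    exact prob_le_one
  have hle : ∀ k, μ (visits X j k) ≤ F ^ k := by
    intro k
    induction k with
    | zero => simpa using prob_le_one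
    | succ k ih =>
      rw [hX.measure_visits_succ, pow_succ]
      gcongr
  have hnull : μ (⋂ k, visits X j k) = 0 := by
    refine le_antisymm ?_ zero_le
    refine ge_of_tendsto' (ENNReal.tendsto_pow_atTop_nhds_zero_of_lt_one hF1) fun k => ?_
    exact (measure_mono (Set.iInter_subset _ k)).trans (hle k)
  filter_upwards [measure_eq_zero_iff_ae_notMem.1 hnull] with ω hω
  by_contra h
  exact hω (Set.mem_iInter.2 (infinite_iff_visits.1 h))

open Classical in
theorem IsMarkovChain.ae_tendsto_count_div_of_isRecurrent (hX : IsMarkovChain μ P X) {j : S}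
    (hj : IsRecurrent P j) : ∀ᵐ ω ∂μ, ω ∈ visitEvent X j →
      Tendsto (fun n : ℕ => (Nat.count (fun k => X k ω = j) n : ℝ) / n) atTop
        (𝓝 (meanRecurrenceTime P j).toReal⁻¹) := by
  set A := visitEvent X j with hAdef
  have hA : MeasurableSet A := by
    rw [hAdef, ← visits_zero]
    exact measurableSet_visits hX.measurable j 0
  have hvisits : ∀ k, μ (visits X j k) = μ A := by
    intro k
    induction k with
    | zero => rw [visits_zero]
    | succ k ih => rw [hX.measure_visits_succ, ih, (isRecurrent_iff P j).1 hj, mul_one]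
  -- Returns are certain, so all the decreasing events `visits X j k` have the measure of `A`.
  have hnull : ∀ k, μ (A \ visits X j k) = 0 := fun k => by
    rw [measure_sdiff (visits_subset_visitEvent k)
      (measurableSet_visits hX.measurable j k).nullMeasurableSet (measure_ne_top _ _), hvisits,
      tsub_self]
  by_cases hA0 : μ A = 0
  · filter_upwards [measure_eq_zero_iff_ae_notMem.1 hA0] with ω h1 h2
    exact absurd h2 h1
  let ν := μ[|A]
  have : IsProbabilityMeasure ν := cond_isProbabilityMeasure hA0
  have hνμ : ∀ p : Ω → Prop, (∀ᵐ ω ∂ν, p ω) ↔ ∀ᵐ ω ∂μ, ω ∈ A → p ω := by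
    intro p
    rw [← ae_restrict_iff' hA]
    exact Measure.ae_ennreal_smul_measure_iff (ENNReal.inv_ne_zero.2 (measure_ne_top _ _))
  rw [← hνμ]
  have hinf : ∀ᵐ ω ∂ν, (Set.ofPred fun n => X n ω = j).Infinite := by
    have : ∀ k, ∀ᵐ ω ∂ν, ω ∈ visits X j k := by
      intro k
      rw [hνμ]
      filter_upwards [measure_eq_zero_iff_ae_notMem.1 (hnull k)] with ω h1 h2
      by_contra h3
      exact h1 ⟨h2, h3⟩
    filter_upwards [ae_all_iff.2 this] with ω hω
    exact infinite_iff_visits.2 hω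
  have hgap : ∀ k b, gap X j k ⁻¹' {b} =ᵐ[ν] gapEvent X j k b := by
    intro k b
    filter_upwards [hinf] with ω hω
    exact propext (mem_gapEvent_iff hω).symm
  have hlaw : ∀ k b, ν (gap X j k ⁻¹' {b}) = hitProb P j b j := by
    intro k b
    rw [measure_congr (hgap k b), cond_apply hA,
      Set.inter_eq_right.2 (gapEvent_subset_visitEvent k b), hX.measure_gapEvent, hvisits,
      ← mul_assoc, ENNReal.inv_mul_cancel hA0 (measure_ne_top _ _), one_mul]
  have hjoint : ∀ i k, i < k → ∀ a b, ν (gap X j i ⁻¹' {a} ∩ gap X j k ⁻¹' {b}) =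
      ν (gap X j i ⁻¹' {a}) * ν (gap X j k ⁻¹' {b}) := by
    intro i k hik a b
    rw [hlaw k b, measure_congr ((hgap i a).inter (hgap k b)), measure_congr (hgap i a),
      cond_apply hA, cond_apply hA, ← Set.inter_assoc,
      Set.inter_eq_right.2 (gapEvent_subset_visitEvent i a),
      hX.measure_inter_gapEvent j fun s => dependsOnPast_gapEvent_inter hik a s, mul_assoc,
      measure_inter_conull']
    exact measure_mono_null (Set.sdiff_subset_sdiff_left (gapEvent_subset_visitEvent i a))
      (hnull k)
  have hmeas := measurable_gap hX.measurable j
  have hindep : Pairwise fun i k => IndepFun (gap X j i) (gap X j k) ν := by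
    intro i k hik
    rcases lt_or_gt_of_ne hik with h | h
    · exact indepFun_of_measure_inter_fiber (hmeas i) (hmeas k) (hjoint i k h)
    · exact (indepFun_of_measure_inter_fiber (hmeas k) (hmeas i) (hjoint k i h)).symm
  have hident : ∀ k, IdentDistrib (gap X j k) (gap X j 0) ν ν := fun k =>
    ⟨(hmeas k).aemeasurable, (hmeas 0).aemeasurable, Measure.ext_of_singleton fun b => by
      rw [Measure.map_apply (hmeas k) (measurableSet_singleton b),
        Measure.map_apply (hmeas 0) (measurableSet_singleton b), hlaw, hlaw]⟩
  have hmean : ∫⁻ ω, ((gap X j 0 ω + 1 : ℕ) : ℝ≥0∞) ∂ν = meanRecurrenceTime P j := by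
    rw [hj.meanRecurrenceTime_eq, ← lintegral_map (f := fun b : ℕ => ((b + 1 : ℕ) : ℝ≥0∞))
      measurable_from_nat (hmeas 0), lintegral_countable']
    refine tsum_congr fun b => ?_
    rw [Measure.map_apply (hmeas 0) (measurableSet_singleton b), hlaw]
  have hlln := ae_tendsto_div_sum (ν := ν) (Y := fun k ω => gap X j k ω + 1)
    (fun k ω => Nat.le_add_left _ _)
    (fun i k hik => (hindep hik).comp (measurable_from_nat (f := fun m => m + 1))
      (measurable_from_nat (f := fun m => m + 1)))
    fun k => (hident k).comp (measurable_from_nat (f := fun m => m + 1))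
  rw [hmean] at hlln
  filter_upwards [hlln, hinf] with ω hω hi
  refine tendsto_count_div hi ?_
  set T : ℕ → ℝ := fun n => ∑ k ∈ Finset.range n, ((gap X j k ω + 1 : ℕ) : ℝ) with hT
  set c : ℝ := (Nat.nth (fun n => X n ω = j) 0 : ℝ) with hc
  have hnth : ∀ n : ℕ, (Nat.nth (fun n => X n ω = j) n : ℝ) = T n + c := fun n => by
    rw [← sum_gap hi n, hT, hc]
    push_cast
    rfl
  have hTn : ∀ n : ℕ, (n : ℝ) ≤ T n := fun n => by
    have : ∑ k ∈ Finset.range n, (1 : ℝ) ≤ T n :=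
      Finset.sum_le_sum fun k _ => Nat.one_le_cast.2 (Nat.le_add_left _ _)
    simpa using this
  have hTc : Tendsto (fun n => T n + c) atTop atTop :=
    tendsto_atTop_add_const_right _ c (tendsto_atTop_mono hTn tendsto_natCast_atTop_atTop)
  have hlim := hω.mul ((hTc.const_div_atTop c).const_sub 1)
  rw [sub_zero, mul_one] at hlim
  -- The time `c` of the first visit is negligible: n / (T + c) = (n / T) (1 - c / (T + c)).
  refine hlim.congr' ?_
  filter_upwards [eventually_gt_atTop 0] with n hn
  have h1 : 0 < T n := (Nat.cast_pos.2 hn).trans_le (hTn n)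
  have h2 : T n + c ≠ 0 := (add_pos_of_pos_of_nonneg h1 (Nat.cast_nonneg _)).ne'
  rw [hnth]
  change (n : ℝ) / T n * (1 - c / (T n + c)) = n / (T n + c)
  have h3 := h1.ne'
  field_simp
  ring

open Classical in
theorem IsMarkovChain.ae_tendsto_count_div (hX : IsMarkovChain μ P X) (j : S) : ∀ᵐ ω ∂μ,
    Tendsto (fun n : ℕ => (Nat.count (fun k => X k ω = j) n : ℝ) / n) atTop
      (𝓝 (if IsPositiveRecurrent P j then (meanRecurrenceTime P j).toReal⁻¹ *
        (visitEvent X j).indicator (fun _ => (1 : ℝ)) ω else 0)) := by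
  by_cases hj : IsRecurrent P j
  · filter_upwards [hX.ae_tendsto_count_div_of_isRecurrent hj] with ω hω
    by_cases hA : ω ∈ visitEvent X j
    · have : (if IsPositiveRecurrent P j then (meanRecurrenceTime P j).toReal⁻¹ *
          (visitEvent X j).indicator (fun _ => (1 : ℝ)) ω else 0) =
          (meanRecurrenceTime P j).toReal⁻¹ := by
        split_ifs with h
        · simp [hA]
        -- Null recurrence: `toReal` sends ∞ to 0 and the inverse of 0 is 0, which is the correct
        -- limit.
        · have : meanRecurrenceTime P j = ∞ := by
            by_contra hne
            exact h ⟨hj, lt_top_iff_ne_top.2 hne⟩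
          simp [this]
      rw [this]
      exact hω hA
    · have h0 : ∀ n, Nat.count (fun k => X k ω = j) n = 0 := fun n =>
        Nat.count_iff_forall_not.2 fun m _ h => hA ⟨m, h⟩
      simp [h0, hA]
  · filter_upwards [hX.ae_finite_visits hj] with ω hω
    rw [if_neg fun h => hj h.1]
    exact tendsto_count_div_of_finite hω

end Occupation

/-! ### From single states to summable functions. -/

/-- The time average is a weighted sum of the visit frequencies. -/
theorem hasSum_count {S : Type*} (g : S → ℝ) (x : ℕ → S)
    [∀ j, DecidablePred fun k => x k = j] (n : ℕ) :
    HasSum (fun j => g j * Nat.count (fun k => x k = j) n) (∑ k ∈ Finset.range n, g (x k)) := by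
  classical
  induction n with
  | zero => simp
  | succ n ih =>
    rw [Finset.sum_range_succ]
    refine (ih.add (hasSum_ite_eq (x n) (g (x n)))).congr_fun fun j => ?_
    rw [Nat.count_succ]
    by_cases h : x n = j
    · subst h
      simp [mul_add]
    · simp [h, Ne.symm h]

theorem tendsto_average_of_tendsto_count {S : Type*} {g : S → ℝ} (hg : Summable fun i => |g i|)
    {x : ℕ → S} {L : S → ℝ} [∀ j, DecidablePred fun k => x k = j]
    (h : ∀ j, Tendsto (fun n : ℕ => (Nat.count (fun k => x k = j) n : ℝ) / n) atTop (𝓝 (L j))) :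
    Summable (fun j => g j * L j) ∧
    Tendsto (fun n : ℕ => (1 / (n : ℝ)) * ∑ k ∈ Finset.Icc 1 n, g (x k)) atTop
      (𝓝 (∑' j, g j * L j)) := by
  have hfreq : ∀ j n, |(Nat.count (fun k => x k = j) n : ℝ) / n| ≤ 1 := fun j n => by
    rw [abs_of_nonneg (by positivity)]
    exact div_le_one_of_le₀ (Nat.cast_le.2 (Nat.count_le _)) (Nat.cast_nonneg n)
  have hL : ∀ j, |L j| ≤ 1 := fun j => le_of_tendsto' (h j).abs (hfreq j)
  have hbound : ∀ j (t : ℝ), |t| ≤ 1 → ‖g j * t‖ ≤ |g j| := fun j t ht => by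
    rw [norm_mul, Real.norm_eq_abs, Real.norm_eq_abs]
    exact mul_le_of_le_one_right (abs_nonneg _) ht
  refine ⟨Summable.of_norm_bounded hg fun j => hbound j _ (hL j), ?_⟩
  have hmain : Tendsto (fun n : ℕ => (∑ k ∈ Finset.range n, g (x k)) / n) atTop
      (𝓝 (∑' j, g j * L j)) := by
    refine (tendsto_tsum_of_dominated_convergence hg (fun j => (h j).const_mul (g j))
      (Eventually.of_forall fun n j => hbound j _ (hfreq j n))).congr fun n => ?_
    rw [← ((hasSum_count g x n).div_const (n : ℝ)).tsum_eq]
    exact tsum_congr fun j => (mul_div_assoc _ _ _).symm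
  -- Counts run over times 0 to n - 1 but the average over 1 to n; the correction vanishes since
  -- `|g|` is bounded by its sum.
  have hdiff : Tendsto (fun n : ℕ => (g (x n) - g (x 0)) / n) atTop (𝓝 0) := by
    refine squeeze_zero_norm (fun n => ?_)
      (tendsto_const_div_atTop_nhds_zero_nat ((∑' j, |g j|) + |g (x 0)|))
    rw [norm_div, Real.norm_natCast, Real.norm_eq_abs]
    gcongr
    refine (abs_sub _ _).trans ?_
    gcongr
    exact hg.le_tsum (x n) fun _ _ => abs_nonneg _
  have hadd := hmain.add hdiff
  rw [add_zero] at hadd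
  refine hadd.congr fun n => ?_
  have hsum : ∑ k ∈ Finset.range n, g (x k) + g (x n) = g (x 0) + ∑ k ∈ Finset.Icc 1 n, g (x k) := by
    rw [← Finset.sum_range_succ, Finset.range_eq_Ico, Finset.sum_eq_sum_Ico_succ_bot n.succ_pos]
    rfl
  rw [← add_div, ← add_sub_assoc, hsum, add_sub_cancel_left, one_div, div_eq_inv_mul]

end DiscreteMarkov

theorem mainTheorem4 {S : Type*} [Countable S] [MeasurableSpace S] [MeasurableSingletonClass S]
    {Ω : Type*} [MeasurableSpace Ω] (μ : Measure Ω) [IsProbabilityMeasure μ]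
    (P : Kernel S S) [IsMarkovKernel P] (X : ℕ → Ω → S)
    (hX : DiscreteMarkov.IsMarkovChain μ P X)
    (g : S → ℝ) (hg : Summable fun i => |g i|) :
    ∀ᵐ ω ∂μ,
      Summable (fun j : {j : S // DiscreteMarkov.IsPositiveRecurrent P j} =>
        g j / (DiscreteMarkov.meanRecurrenceTime P (j : S)).toReal *
          (DiscreteMarkov.visitEvent X (j : S)).indicator (fun _ => (1 : ℝ)) ω) ∧
      Tendsto (fun n : ℕ => (1 / (n : ℝ)) * ∑ k ∈ Finset.Icc 1 n, g (X k ω)) atTop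
        (𝓝 (∑' j : {j : S // DiscreteMarkov.IsPositiveRecurrent P j},
          g j / (DiscreteMarkov.meanRecurrenceTime P (j : S)).toReal *
            (DiscreteMarkov.visitEvent X (j : S)).indicator (fun _ => (1 : ℝ)) ω)) := by
  classical
  filter_upwards [ae_all_iff.2 hX.ae_tendsto_count_div] with ω hω
  obtain ⟨h1, h2⟩ := DiscreteMarkov.tendsto_average_of_tendsto_count hg hω
  have heq : (fun j => g j * (if DiscreteMarkov.IsPositiveRecurrent P j then
      (DiscreteMarkov.meanRecurrenceTime P j).toReal⁻¹ *
        (DiscreteMarkov.visitEvent X j).indicator (fun _ => (1 : ℝ)) ω else 0)) =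
      ({j | DiscreteMarkov.IsPositiveRecurrent P j} : Set S).indicator fun j =>
        g j / (DiscreteMarkov.meanRecurrenceTime P j).toReal *
          (DiscreteMarkov.visitEvent X j).indicator (fun _ => (1 : ℝ)) ω := by
    funext j
    by_cases hj : DiscreteMarkov.IsPositiveRecurrent P j
    · rw [if_pos hj, Set.indicator_of_mem
        (show j ∈ {j | DiscreteMarkov.IsPositiveRecurrent P j} from hj), ← mul_assoc, div_eq_mul_inv]
    · rw [if_neg hj, Set.indicator_of_notMem
        (show j ∉ {j | DiscreteMarkov.IsPositiveRecurrent P j} from hj), mul_zero]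
  rw [heq] at h1 h2
  rw [← tsum_subtype] at h2
  exact ⟨summable_subtype_iff_indicator.2 h1, h2⟩
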